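/- Let $K$ be a field and let $n\ge 0$ be an integer. Let $A_n$ be the linearly oriented path quiver, with vertices $1,\dots,n$ and a unique arrow $i\to i+1$ for each $1\le i\le n-1$, and let $\operatorname{rep}A_n$ be the category of its finite-dimensional representations over $K$. A torsion class in $\operatorname{rep}A_n$ is a full subcategory whose objects are, up to isomorphism, exactly the finite direct sums (including the empty one) of members of some set of indecomposable representations, and which is closed under quotients and under extensions: if $Y$ lies in it and $Y\to Z$ is a surjection, then $Z$ lies in it; and if $X,Z$ lie in it and $Y$ has a subrepresentation isomorphic to $X$ with quotient isomorphic to $Z$, then $Y$ lies in it. Then the torsion classes in $\operatorname{rep}A_n$, ordered by inclusion, form a poset isomorphic to the Tamari lattice $T_n$. Here $T_n$ is the set of complete binary bracketings of a word of $n+2$ letters (equivalently, binary trees with $n+1$ internal nodes), where $s\le t$ if and only if $t$ is obtained from $s$ by finitely many (possibly zero) replacements of a sub-bracketing $(AB)C$ by $A(BC)$. -/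

import Mathlib

open CategoryTheory

universe u v w

/-- A representation of a quiver `Q` over a field `K`: a finite-dimensional `K`-vector space at
each vertex and a linear map for each arrow. -/
structure QuiverRep (K : Type u) [Field K] (Q : Type w) [Quiver.{v} Q] where
  obj : Q → Type u
  [addCommGroup : ∀ i, AddCommGroup (obj i)]
  [module : ∀ i, Module K (obj i)]
  [finiteDimensional : ∀ i, FiniteDimensional K (obj i)]
  map : ∀ {i j : Q}, (i ⟶ j) → (obj i →ₗ[K] obj j)

attribute [instance] QuiverRep.addCommGroup QuiverRep.module QuiverRep.finiteDimensional

namespace QuiverRep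

variable {K : Type u} [Field K] {Q : Type w} [Quiver.{v} Q]

/-- A morphism of representations: linear maps `f i` at the vertices that commute with the
structure maps, `W_α ∘ f_i = f_j ∘ V_α` for every arrow `α : i ⟶ j`. -/
@[ext]
structure Hom (V W : QuiverRep K Q) where
  app : ∀ i : Q, V.obj i →ₗ[K] W.obj i
  comm : ∀ {i j : Q} (α : i ⟶ j), W.map α ∘ₗ app i = app j ∘ₗ V.map α

/-- The category `rep Q`. -/
instance : Category (QuiverRep K Q) where
  Hom V W := Hom V W
  id V := { app := fun _ => LinearMap.id, comm := fun _ => rfl }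
  comp {U V W} f g :=
    { app := fun i => g.app i ∘ₗ f.app i
      comm := fun {i j} α => by
        rw [← LinearMap.comp_assoc, g.comm, LinearMap.comp_assoc, f.comm, LinearMap.comp_assoc] }

/-- A morphism is an injection if all its linear maps are injective. -/
def IsInjection {V W : QuiverRep K Q} (f : V ⟶ W) : Prop :=
  ∀ i, Function.Injective (Hom.app f i)

/-- A morphism is a surjection if all its linear maps are surjective. -/
def IsSurjection {V W : QuiverRep K Q} (f : V ⟶ W) : Prop :=
  ∀ i, Function.Surjective (Hom.app f i)

/-- The zero representations: all vector spaces are zero. -/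
def IsZeroRep (V : QuiverRep K Q) : Prop :=
  ∀ i, Subsingleton (V.obj i)

/-- The direct sum of two representations. -/
def directSum (V W : QuiverRep K Q) : QuiverRep K Q where
  obj i := V.obj i × W.obj i
  map α := (V.map α).prodMap (W.map α)

/-- The direct sum of a finite family of representations (as the family is finite, the direct
sum of the spaces at a vertex is their product). -/
def finiteDirectSum {m : ℕ} (V : Fin m → QuiverRep K Q) : QuiverRep K Q where
  obj i := ∀ k, (V k).obj i
  map α := LinearMap.pi fun k => (V k).map α ∘ₗ LinearMap.proj k

/-- A non-zero representation is indecomposable if it is not isomorphic to the direct sum of two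
non-zero representations. -/
def IsIndecomposable (V : QuiverRep K Q) : Prop :=
  ¬ V.IsZeroRep ∧
    ∀ X Y : QuiverRep K Q, Nonempty (V ≅ directSum X Y) → X.IsZeroRep ∨ Y.IsZeroRep

/-- `Y` is an extension of `Z` by `X`: there is a subrepresentation of `Y` isomorphic to `X`
(the image of an injection `f`) with quotient isomorphic to `Z` (a surjection `g` whose kernel
is the image of `f`). -/
def IsExtension (Y Z X : QuiverRep K Q) : Prop :=
  ∃ (f : X ⟶ Y) (g : Y ⟶ Z), IsInjection f ∧ IsSurjection g ∧
    ∀ i, LinearMap.range (Hom.app f i) = LinearMap.ker (Hom.app g i)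

/-- A full additive subcategory of `rep Q`, given by its objects: for some set of indecomposable
representations, the objects are (up to isomorphism) the finite direct sums, the empty one
included, of members of this set. -/
def IsAdditiveSubcategory (B : ObjectProperty (QuiverRep K Q)) : Prop :=
  ∃ S : Set (QuiverRep K Q), (∀ V ∈ S, V.IsIndecomposable) ∧
    ∀ X : QuiverRep K Q, B X ↔
      ∃ (m : ℕ) (V : Fin m → QuiverRep K Q),
        (∀ k, V k ∈ S) ∧ Nonempty (X ≅ finiteDirectSum V)

/-- A torsion class: a full additive subcategory closed under quotients and extensions. -/
structure IsTorsionClass (B : ObjectProperty (QuiverRep K Q)) : Prop where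
  additive : IsAdditiveSubcategory B
  quotient : ∀ {Y Z : QuiverRep K Q} (f : Y ⟶ Z), IsSurjection f → B Y → B Z
  extension : ∀ {X Y Z : QuiverRep K Q}, IsExtension Y Z X → B X → B Z → B Y

end QuiverRep

/-- The vertices of the linearly oriented path quiver `A_n`. -/
def PathQuiver (n : ℕ) : Type := Fin n

/-- The arrows of `A_n`: a unique arrow from each vertex to the next one, and no others. -/
instance (n : ℕ) : Quiver.{0} (PathQuiver n) where
  Hom (i j : Fin n) := PLift (i.val + 1 = j.val)

/-- The torsion classes of `rep A_n`, ordered by inclusion (the order of `ObjectProperty`). -/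
abbrev TorsionClasses (K : Type u) [Field K] (n : ℕ) : Type (u + 1) :=
  {B : ObjectProperty (QuiverRep K (PathQuiver n)) // QuiverRep.IsTorsionClass B}

/-- One application of the semi-associative law `(A B) C → A (B C)` at some place in a binary
bracketing. Bracketings are binary trees: `nil` is a letter, `node () A B` the product `A B`. -/
inductive TamariStep : BinaryTree Unit → BinaryTree Unit → Prop
  | rotate (A B C : BinaryTree Unit) :
      TamariStep (.node () (.node () A B) C) (.node () A (.node () B C))
  | left {A A' : BinaryTree Unit} (B : BinaryTree Unit) :
      TamariStep A A' → TamariStep (.node () A B) (.node () A' B)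
  | right (A : BinaryTree Unit) {B B' : BinaryTree Unit} :
      TamariStep B B' → TamariStep (.node () A B) (.node () A B')

theorem TamariStep.numNodes_eq {s t : BinaryTree Unit} (h : TamariStep s t) :
    s.numNodes = t.numNodes := by
  induction h with
  | rotate A B C => simp only [BinaryTree.numNodes]; omega
  | left B _ ih => simp only [BinaryTree.numNodes, ih]
  | right A _ ih => simp only [BinaryTree.numNodes, ih]

/-- The sum, over all nodes, of the size of the right subtree. -/
def tamariWeight : BinaryTree Unit → ℕ
  | .nil => 0
  | .node _ A B => tamariWeight A + tamariWeight B + B.numNodes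

theorem TamariStep.weight_lt {s t : BinaryTree Unit} (h : TamariStep s t) :
    tamariWeight s < tamariWeight t := by
  induction h with
  | rotate A B C => simp only [tamariWeight, BinaryTree.numNodes]; omega
  | left B _ ih => simp only [tamariWeight]; omega
  | right A h ih => have := h.numNodes_eq; simp only [tamariWeight]; omega

theorem tamari_eq_or_weight_lt {s t : BinaryTree Unit} (h : Relation.ReflTransGen TamariStep s t) :
    s = t ∨ tamariWeight s < tamariWeight t := by
  induction h with
  | refl => exact Or.inl rfl
  | tail _ h ih =>
    rcases ih with rfl | ih
    · exact Or.inr h.weight_lt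
    · exact Or.inr (ih.trans h.weight_lt)

/-- The Tamari lattice `T_n`: the binary bracketings of `n + 2` letters (binary trees with `n + 1`
internal nodes). -/
def TamariLattice (n : ℕ) : Type :=
  {t : BinaryTree Unit // t.numNodes = n + 1}

/-- The Tamari order: `s ≤ t` if `t` arises from `s` by finitely many (possibly no) applications
of `(A B) C → A (B C)`. -/
instance (n : ℕ) : PartialOrder (TamariLattice n) where
  le s t := Relation.ReflTransGen TamariStep s.1 t.1
  le_refl _ := Relation.ReflTransGen.refl
  le_trans _ _ _ h₁ h₂ := Relation.ReflTransGen.trans h₁ h₂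
  le_antisymm s t h₁ h₂ := by
    rcases tamari_eq_or_weight_lt h₁ with h | h
    · exact Subtype.ext h
    · rcases tamari_eq_or_weight_lt h₂ with h' | h'
      · exact Subtype.ext h'.symm
      · omega

/-!
An interval representation `[a, b)` of the path quiver is `K` at the vertices `v` with
`a ≤ v < b`, and `0` elsewhere; the vertices are numbered from `0`. Every representation is a finite
direct sum of interval representations (`exists_iso_finiteDirectSum_intervalRep`), so a torsion
class is determined by the intervals it contains (`IsQuotExtClosed.le_iff`). The quotients of
`[a, b)` are the `[a, c)` with `c ≤ b`, and `[a, c)` is an extension of `[a, b)` by `[b, c)`. Hence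
the intervals in a torsion class are the `[i, j)` with `i < j ≤ i + r i` for a vector `r` such that
the intervals `[i, i + r i]` in `{0, …, n}` are nested or disjoint, in the sense that
`i ≤ j ≤ i + r i` implies `j + r j ≤ i + r i` (`IsQuotExtClosed.exists_vector`).

Conversely, such a vector `r` gives the class `homOrthogonal` of the representations `X` with
`Hom(X, [k, l)) = 0` whenever `i + r i < l` for all `i` in `[k, l)`. Like every class defined by the
vanishing of morphisms out of it, it is closed under quotients and extensions, and by the
decomposition theorem it is additive. A nonzero morphism `[i, j) → [k, l)` exists only if
`k ≤ i < l ≤ j`, and this shows that the class contains precisely the prescribed intervals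
(`homOrthogonal_intervalRep_iff`).

The vectors with these properties are also the bracket vectors of the binary trees with `n + 1`
nodes: `r i` is the size of the right subtree of the `i`-th node in inorder
(`exists_bracketVector_eq`). A rotation enlarges the bracket vector at a single place. If the vector
of `s` is at most that of `t`, the node of `s` in the position of the root of `t` lies on the left
spine of `s`; rotating it to the root changes no other entry, and induction on the two subtrees
shows that `t` arises from `s` by rotations (`reflTransGen_of_bracketVector_le`). So the Tamari
order is the pointwise order of bracket vectors, and this corresponds to inclusion of torsion
classes.
-/

namespace QuiverRep

section General

variable {K : Type u} [Field K] {Q : Type w} [Quiver.{v} Q]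

/-! ### Morphisms and direct sums of representations -/

theorem comm_apply {X Y : QuiverRep K Q} (f : X ⟶ Y) {i j : Q} (α : i ⟶ j) (x : X.obj i) :
    Y.map α (Hom.app f i x) = Hom.app f j (X.map α x) :=
  LinearMap.congr_fun (Hom.comm f α) x

theorem app_inv_app_hom {X Y : QuiverRep K Q} (e : X ≅ Y) (i : Q) (x : X.obj i) :
    Hom.app e.inv i (Hom.app e.hom i x) = x :=
  congrArg (fun f : X ⟶ X => Hom.app f i x) e.hom_inv_id

theorem app_hom_app_inv {X Y : QuiverRep K Q} (e : X ≅ Y) (i : Q) (y : Y.obj i) :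
    Hom.app e.hom i (Hom.app e.inv i y) = y :=
  congrArg (fun f : Y ⟶ Y => Hom.app f i y) e.inv_hom_id

theorem isSurjection_hom {X Y : QuiverRep K Q} (e : X ≅ Y) : IsSurjection e.hom :=
  fun i y => ⟨Hom.app e.inv i y, app_hom_app_inv e i y⟩

/-- A morphism that is bijective at each vertex is an isomorphism. -/
noncomputable def isoOfBijective {X Y : QuiverRep K Q} (f : X ⟶ Y)
    (hf : ∀ i, Function.Bijective (Hom.app f i)) : X ≅ Y where
  hom := f
  inv :=
    { app := fun i => (LinearEquiv.ofBijective (Hom.app f i) (hf i)).symm.toLinearMap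
      comm := fun {i j} α => by
        ext y
        apply (hf j).1
        have h₁ := (LinearEquiv.ofBijective (Hom.app f j) (hf j)).apply_symm_apply (Y.map α y)
        have h₂ := (LinearEquiv.ofBijective (Hom.app f i) (hf i)).apply_symm_apply y
        rw [LinearEquiv.ofBijective_apply] at h₁ h₂
        simp only [LinearMap.comp_apply, LinearEquiv.coe_coe]
        rw [h₁, ← comm_apply f α, h₂] }
  hom_inv_id := Hom.ext <| funext fun i => LinearMap.ext fun x =>
    (LinearEquiv.ofBijective (Hom.app f i) (hf i)).symm_apply_apply x
  inv_hom_id := Hom.ext <| funext fun i => LinearMap.ext fun y =>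
    (LinearEquiv.ofBijective (Hom.app f i) (hf i)).apply_symm_apply y

/-- The projection of a finite direct sum onto a summand. -/
def finiteDirectSumProj {m : ℕ} (V : Fin m → QuiverRep K Q) (k : Fin m) :
    finiteDirectSum V ⟶ V k :=
  Hom.mk (V := finiteDirectSum V) (W := V k) (fun _ => LinearMap.proj k) fun _ => rfl

theorem isSurjection_finiteDirectSumProj {m : ℕ} (V : Fin m → QuiverRep K Q) (k : Fin m) :
    IsSurjection (finiteDirectSumProj V k) :=
  fun i => LinearMap.proj_surjective (φ := fun k => (V k).obj i) k

/-- The morphism that splits off the first summand of a finite direct sum. -/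
def finiteDirectSumCons {m : ℕ} (V : Fin (m + 1) → QuiverRep K Q) :
    directSum (V 0) (finiteDirectSum fun k => V k.succ) ⟶ finiteDirectSum V :=
  Hom.mk (V := directSum (V 0) (finiteDirectSum fun k => V k.succ)) (W := finiteDirectSum V)
    (fun i => (Fin.consLinearEquiv K fun k => (V k).obj i).toLinearMap) fun {i j} α => by
      refine LinearMap.ext fun x => funext fun k => ?_
      refine Fin.cases ?_ (fun k => ?_) k <;> rfl

theorem bijective_finiteDirectSumCons {m : ℕ} (V : Fin (m + 1) → QuiverRep K Q) (i : Q) :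
    Function.Bijective (Hom.app (finiteDirectSumCons V) i) :=
  (Fin.consLinearEquiv K fun k => (V k).obj i).bijective

/-- A direct sum is an extension of its second summand by its first. -/
theorem isExtension_directSum (X Y : QuiverRep K Q) : IsExtension (directSum X Y) Y X :=
  ⟨Hom.mk (V := X) (W := directSum X Y) (fun _ => LinearMap.inl _ _ _) fun α =>
      LinearMap.ext fun _ => Prod.ext rfl (map_zero (Y.map α)),
    Hom.mk (V := directSum X Y) (W := Y) (fun _ => LinearMap.snd _ _ _) fun _ => rfl,
    fun _ => LinearMap.inl_injective, fun _ => LinearMap.snd_surjective,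
    fun i => LinearMap.range_inl K (X.obj i) (Y.obj i)⟩

/-- The kernel of a morphism. -/
def kernelRep {X Y : QuiverRep K Q} (f : X ⟶ Y) : QuiverRep K Q where
  obj i := LinearMap.ker (Hom.app f i)
  map {i j} α := (X.map α).restrict fun x hx => by
    rw [LinearMap.mem_ker] at hx ⊢
    rw [← comm_apply, hx, map_zero]

/-- A representation with a retraction onto `M` is the direct sum of `M` and the kernel of the
retraction. -/
theorem nonempty_iso_directSum_kernelRep {X M : QuiverRep K Q} (ι : M ⟶ X) (ρ : X ⟶ M)
    (h : ∀ i x, Hom.app ρ i (Hom.app ι i x) = x) : Nonempty (directSum M (kernelRep ρ) ≅ X) := by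
  refine ⟨isoOfBijective (Hom.mk (V := directSum M (kernelRep ρ)) (W := X)
    (fun i => (Hom.app ι i).coprod (LinearMap.ker (Hom.app ρ i)).subtype) ?_) fun i => ⟨?_, ?_⟩⟩
  · intro i j α
    refine LinearMap.ext fun x => ?_
    change X.map α (Hom.app ι i x.1 + x.2.1) = Hom.app ι j (M.map α x.1) + X.map α x.2.1
    rw [map_add, comm_apply]
  · refine (injective_iff_map_eq_zero _).2 fun x hx => ?_
    change Hom.app ι i x.1 + x.2.1 = 0 at hx
    have h₁ : x.1 = 0 := by
      have := congrArg (Hom.app ρ i) hx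
      rwa [map_add, h, LinearMap.mem_ker.1 x.2.2, add_zero, map_zero] at this
    rw [h₁, map_zero, zero_add] at hx
    exact Prod.ext h₁ (Subtype.ext hx)
  · intro x
    refine ⟨(Hom.app ρ i x, ⟨x - Hom.app ι i (Hom.app ρ i x), ?_⟩), ?_⟩
    · rw [LinearMap.mem_ker, map_sub, h, sub_self]
    · exact add_sub_cancel (Hom.app ι i (Hom.app ρ i x)) x

/-- A class of representations that contains the zero representations and is closed under
quotients and extensions. -/
structure IsQuotExtClosed (B : ObjectProperty (QuiverRep K Q)) : Prop where
  zero : ∀ {X : QuiverRep K Q}, X.IsZeroRep → B X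
  quotient : ∀ {Y Z : QuiverRep K Q} (f : Y ⟶ Z), IsSurjection f → B Y → B Z
  extension : ∀ {X Y Z : QuiverRep K Q}, IsExtension Y Z X → B X → B Z → B Y

theorem IsQuotExtClosed.iff_of_iso {B : ObjectProperty (QuiverRep K Q)} (hB : IsQuotExtClosed B)
    {X Y : QuiverRep K Q} (e : X ≅ Y) : B X ↔ B Y :=
  ⟨hB.quotient e.hom (isSurjection_hom e), hB.quotient e.inv (isSurjection_hom e.symm)⟩

theorem IsQuotExtClosed.finiteDirectSum_iff {B : ObjectProperty (QuiverRep K Q)}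
    (hB : IsQuotExtClosed B) {m : ℕ} (V : Fin m → QuiverRep K Q) :
    B (finiteDirectSum V) ↔ ∀ k, B (V k) := by
  refine ⟨fun h k => hB.quotient _ (isSurjection_finiteDirectSumProj V k) h, fun h => ?_⟩
  induction m with
  | zero => exact hB.zero fun i => ⟨fun x y => funext fun k => k.elim0⟩
  | succ m ih =>
    rw [← hB.iff_of_iso (isoOfBijective _ (bijective_finiteDirectSumCons V))]
    exact hB.extension (isExtension_directSum _ _) (h 0) (ih _ fun k => h k.succ)

theorem IsTorsionClass.isQuotExtClosed {B : ObjectProperty (QuiverRep K Q)}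
    (hB : IsTorsionClass B) : IsQuotExtClosed B where
  zero {X} hX := by
    obtain ⟨S, -, hS⟩ := hB.additive
    have hb : ∀ i, Function.Bijective (0 : X.obj i →ₗ[K]
        (finiteDirectSum (K := K) (Q := Q) (m := 0) Fin.elim0).obj i) := fun i =>
      ⟨fun x y _ => (hX i).elim x y, fun y => ⟨0, funext fun k => k.elim0⟩⟩
    exact (hS X).2 ⟨0, Fin.elim0, fun k => k.elim0, ⟨isoOfBijective
      (Hom.mk (V := X) (W := finiteDirectSum Fin.elim0) (fun _ => 0) fun α => by simp) hb⟩⟩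
  quotient := hB.quotient
  extension := hB.extension

end General

end QuiverRep

/-! ### Transport along the path -/

namespace PathQuiver

/-- The number of a vertex of the path quiver; the vertices are numbered from `0`. -/
def idx {n : ℕ} (v : PathQuiver n) : ℕ := Fin.val v

instance (n : ℕ) : DecidableEq (PathQuiver n) := inferInstanceAs (DecidableEq (Fin n))

instance (n : ℕ) : Fintype (PathQuiver n) := inferInstanceAs (Fintype (Fin n))

theorem idx_lt {n : ℕ} (v : PathQuiver n) : v.idx < n := Fin.isLt v

theorem idx_injective {n : ℕ} : Function.Injective (idx (n := n)) := Fin.val_injective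

theorem idx_of_hom {n : ℕ} {v w : PathQuiver n} (α : v ⟶ w) : w.idx = v.idx + 1 := α.down.symm

/-- The vertex with a given number. -/
def vertex {n : ℕ} (i : ℕ) (hi : i < n) : PathQuiver n := Fin.mk i hi

@[simp] theorem idx_vertex {n : ℕ} (i : ℕ) (hi : i < n) : (vertex i hi).idx = i := rfl

/-- Induction along the path. -/
theorem path_induction {n : ℕ} {P : PathQuiver n → Prop}
    (zero : ∀ v : PathQuiver n, v.idx = 0 → P v)
    (succ : ∀ (v w : PathQuiver n), (v ⟶ w) → P v → P w) (v : PathQuiver n) : P v := by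
  obtain ⟨i, hi⟩ := v
  induction i with
  | zero => exact zero _ rfl
  | succ i ih => exact succ (vertex i (by omega)) _ ⟨rfl⟩ (ih _)

end PathQuiver

namespace QuiverRep

section Path

variable {K : Type u} [Field K] {n : ℕ}

open PathQuiver

/-- The composite of the structure maps along the path from `v` to the vertex with number `i`, and
`0` if there is no such path, by recursion on `i`. The composite of `LinearMap.single` with
`LinearMap.proj` is the identity if the two vertices agree, and `0` otherwise. -/
def transportAux (X : QuiverRep K (PathQuiver n)) (v : PathQuiver n) :
    (i : ℕ) → (hi : i < n) → X.obj v →ₗ[K] X.obj (vertex i hi)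
  | 0, _ => LinearMap.proj _ ∘ₗ LinearMap.single K X.obj v
  | i + 1, hi => LinearMap.proj _ ∘ₗ LinearMap.single K X.obj v +
      X.map (i := vertex i (Nat.lt_of_succ_lt hi)) ⟨rfl⟩ ∘ₗ
        transportAux X v i (Nat.lt_of_succ_lt hi)

/-- The composite of the structure maps along the path from `v` to `w`, and `0` if there is no
such path. -/
def transport (X : QuiverRep K (PathQuiver n)) (v w : PathQuiver n) : X.obj v →ₗ[K] X.obj w :=
  transportAux X v w.idx w.idx_lt

theorem transport_of_lt (X : QuiverRep K (PathQuiver n)) (v w : PathQuiver n)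
    (h : w.idx < v.idx) : transport X v w = 0 := by
  have key : ∀ w : PathQuiver n, w ≠ v →
      (LinearMap.proj w ∘ₗ LinearMap.single K X.obj v : X.obj v →ₗ[K] X.obj w) = 0 :=
    fun w hw => LinearMap.proj_comp_single_ne K X.obj w v hw
  obtain ⟨i, hi⟩ := w
  change i < v.idx at h
  change transportAux X v i hi = 0
  induction i with
  | zero => exact key _ fun e => by subst e; exact h.ne rfl
  | succ i ih =>
    rw [transportAux, ih _ (by omega), LinearMap.comp_zero, add_zero]
    exact key _ fun e => by subst e; exact h.ne rfl

theorem transport_self (X : QuiverRep K (PathQuiver n)) (v : PathQuiver n) :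
    transport X v v = LinearMap.id := by
  obtain ⟨i, hi⟩ := v
  have key := LinearMap.proj_comp_single_same K X.obj (vertex i hi)
  cases i with
  | zero => exact key
  | succ i =>
    have h := transport_of_lt X (vertex (i + 1) hi) (vertex i (by omega)) (Nat.lt_succ_self i)
    change transportAux X (vertex (i + 1) hi) (i + 1) hi = _
    change transportAux X (vertex (i + 1) hi) i _ = _ at h
    rw [transportAux, h, LinearMap.comp_zero, add_zero]
    exact key

theorem map_comp_transport (X : QuiverRep K (PathQuiver n)) {u v w : PathQuiver n} (α : v ⟶ w)
    (h : u.idx ≤ v.idx) : X.map α ∘ₗ transport X u v = transport X u w := by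
  obtain ⟨i, hi⟩ := v
  obtain ⟨j, hj⟩ := w
  obtain ⟨hα⟩ := α
  change i + 1 = j at hα
  change u.idx ≤ i at h
  subst hα
  change _ = transportAux X u (i + 1) hj
  rw [transportAux]
  have key : (LinearMap.proj (vertex (i + 1) hj) ∘ₗ LinearMap.single K X.obj u :
      X.obj u →ₗ[K] X.obj (vertex (i + 1) hj)) = 0 :=
    LinearMap.proj_comp_single_ne K X.obj _ u fun e => by
      subst e; rw [idx_vertex] at h; omega
  rw [key, zero_add]
  rfl

theorem transport_comp_transport (X : QuiverRep K (PathQuiver n)) {u v : PathQuiver n}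
    (w : PathQuiver n) (huv : u.idx ≤ v.idx) (hvw : v.idx ≤ w.idx) :
    transport X v w ∘ₗ transport X u v = transport X u w := by
  induction w using path_induction with
  | zero w hw =>
    obtain rfl : v = w := idx_injective (by omega)
    rw [transport_self, LinearMap.id_comp]
  | succ w' w α ih =>
    have hα := idx_of_hom α
    rcases eq_or_ne v w with rfl | hne
    · rw [transport_self, LinearMap.id_comp]
    · have : v.idx ≠ w.idx := fun e => hne (idx_injective e)
      rw [← map_comp_transport X α (by omega), ← map_comp_transport X α (by omega),
        LinearMap.comp_assoc, ih (by omega)]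

theorem transport_comp_map (X : QuiverRep K (PathQuiver n)) {u v w : PathQuiver n} (α : u ⟶ v)
    (h : v.idx ≤ w.idx) : transport X v w ∘ₗ X.map α = transport X u w := by
  have hα := idx_of_hom α
  have h₁ := map_comp_transport X α le_rfl
  rw [transport_self, LinearMap.comp_id] at h₁
  rw [h₁, transport_comp_transport X w (by omega) h]

/-! ### Interval representations -/

variable (K n) in
/-- The interval representation of the path quiver: `K` at the vertices `v` with `a ≤ v < b`, and
`0` elsewhere, with the identity of `K` as structure map wherever possible. To have the spaces as
subspaces of `K`, the zero space is taken as the zero subspace. -/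
def intervalRep (a b : ℕ) : QuiverRep K (PathQuiver n) where
  obj v := ↥(if a ≤ v.idx ∧ v.idx < b then ⊤ else ⊥ : Submodule K K)
  map {v w} _ := LinearMap.codRestrict _
    ((if a ≤ w.idx ∧ w.idx < b then 1 else 0 : K) • Submodule.subtype _) fun x => by
      split_ifs <;> simp

/-- The inclusion of the space of an interval representation at a vertex into `K`. -/
def intervalVal {a b : ℕ} {v : PathQuiver n} : (intervalRep K n a b).obj v →ₗ[K] K :=
  Submodule.subtype _

theorem intervalVal_injective {a b : ℕ} {v : PathQuiver n} :
    Function.Injective (intervalVal (K := K) (a := a) (b := b) (v := v)) :=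
  Subtype.val_injective

theorem intervalVal_eq_zero {a b : ℕ} {v : PathQuiver n} (h : ¬ (a ≤ v.idx ∧ v.idx < b))
    (x : (intervalRep K n a b).obj v) : intervalVal x = 0 := by
  have hx : intervalVal x ∈ (if a ≤ v.idx ∧ v.idx < b then ⊤ else ⊥ : Submodule K K) := x.2
  rw [if_neg h] at hx
  exact hx

/-- The element of the interval representation at the vertex `v` with value `c` if `v` belongs to
the interval, and `0` otherwise. -/
def intervalMk (a b : ℕ) (v : PathQuiver n) : K →ₗ[K] (intervalRep K n a b).obj v :=
  LinearMap.codRestrict _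
    ((if a ≤ v.idx ∧ v.idx < b then 1 else 0 : K) • LinearMap.id) fun x => by
      split_ifs <;> simp

theorem intervalVal_intervalMk (a b : ℕ) (v : PathQuiver n) (c : K) :
    intervalVal (intervalMk a b v c) = if a ≤ v.idx ∧ v.idx < b then c else 0 := by
  change (if a ≤ v.idx ∧ v.idx < b then 1 else 0 : K) • c = _
  split_ifs <;> simp

theorem intervalVal_map {a b : ℕ} {v w : PathQuiver n} (α : v ⟶ w)
    (x : (intervalRep K n a b).obj v) :
    intervalVal ((intervalRep K n a b).map α x) =
      if a ≤ w.idx ∧ w.idx < b then intervalVal x else 0 := by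
  change (if a ≤ w.idx ∧ w.idx < b then 1 else 0 : K) • intervalVal x = _
  split_ifs <;> simp

theorem isZeroRep_intervalRep {a b : ℕ} (h : b ≤ a) : (intervalRep K n a b).IsZeroRep :=
  fun v => ⟨fun x y => intervalVal_injective <| by
    rw [intervalVal_eq_zero (by omega), intervalVal_eq_zero (by omega)]⟩

/-- The morphism between interval representations that is the identity of `K` on the
intersection of the two intervals. -/
def intervalHom {a b c d : ℕ} (hac : c ≤ a) (hbd : d ≤ b) :
    intervalRep K n a b ⟶ intervalRep K n c d :=
  Hom.mk (V := intervalRep K n a b) (W := intervalRep K n c d)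
    (fun v => intervalMk c d v ∘ₗ intervalVal) fun {v w} α => by
      refine LinearMap.ext fun x => intervalVal_injective ?_
      have hα := idx_of_hom α
      simp only [LinearMap.comp_apply, intervalVal_map, intervalVal_intervalMk]
      by_cases hv : a ≤ v.idx ∧ v.idx < b
      · by_cases hw : c ≤ w.idx ∧ w.idx < d
        · rw [if_pos hw, if_pos hw, if_pos (by omega), if_pos (by omega)]
        · rw [if_neg hw, if_neg hw]
      · rw [intervalVal_eq_zero hv]
        simp

theorem intervalVal_intervalHom {a b c d : ℕ} (hac : c ≤ a) (hbd : d ≤ b) (v : PathQuiver n)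
    (x : (intervalRep K n a b).obj v) :
    intervalVal (Hom.app (intervalHom hac hbd) v x) =
      if c ≤ v.idx ∧ v.idx < d then intervalVal x else 0 :=
  intervalVal_intervalMk c d v (intervalVal x)

theorem isSurjection_intervalHom {a b d : ℕ} (hbd : d ≤ b) :
    IsSurjection (intervalHom (K := K) (n := n) (le_refl a) hbd) := fun v y => by
  refine ⟨intervalMk a b v (intervalVal y), intervalVal_injective ?_⟩
  rw [intervalVal_intervalHom, intervalVal_intervalMk]
  by_cases h : a ≤ v.idx ∧ v.idx < d
  · rw [if_pos h, if_pos (by omega)]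
  · rw [if_neg h, intervalVal_eq_zero h]

theorem isExtension_intervalRep {a b c : ℕ} (hab : a ≤ b) (hbc : b ≤ c) :
    IsExtension (intervalRep K n a c) (intervalRep K n a b) (intervalRep K n b c) := by
  refine ⟨intervalHom hab le_rfl, intervalHom le_rfl hbc, fun v x y h => ?_,
    isSurjection_intervalHom hbc, fun v => ?_⟩
  · have h := congrArg intervalVal h
    rw [intervalVal_intervalHom, intervalVal_intervalHom] at h
    apply intervalVal_injective
    by_cases hv : b ≤ v.idx ∧ v.idx < c
    · rwa [if_pos (by omega), if_pos (by omega)] at h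
    · rw [intervalVal_eq_zero hv, intervalVal_eq_zero hv]
  · ext y
    rw [LinearMap.mem_range, LinearMap.mem_ker, ← map_eq_zero_iff _ intervalVal_injective,
      intervalVal_intervalHom]
    constructor
    · rintro ⟨x, rfl⟩
      rw [intervalVal_intervalHom]
      by_cases hv : a ≤ v.idx ∧ v.idx < b
      · rw [intervalVal_eq_zero (x := x) (by omega)]
        simp
      · rw [if_neg hv]
    · intro h
      refine ⟨intervalMk b c v (intervalVal y), intervalVal_injective ?_⟩
      rw [intervalVal_intervalHom, intervalVal_intervalMk]
      by_cases hv : a ≤ v.idx ∧ v.idx < c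
      · rw [if_pos hv]
        by_cases hv' : v.idx < b
        · rw [if_pos (by omega)] at h
          rw [if_neg (by omega), h]
        · rw [if_pos (by omega)]
      · rw [if_neg hv, intervalVal_eq_zero hv]

/-- Beyond its first vertex, an interval representation is generated by what precedes. -/
theorem intervalRep_map_surjective {a b : ℕ} {v w : PathQuiver n} (α : v ⟶ w) (hw : w.idx ≠ a) :
    Function.Surjective ((intervalRep K n a b).map α) := fun y => by
  have hα := idx_of_hom α
  refine ⟨intervalMk a b v (intervalVal y), intervalVal_injective ?_⟩
  rw [intervalVal_map, intervalVal_intervalMk]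
  by_cases h : a ≤ w.idx ∧ w.idx < b
  · rw [if_pos h, if_pos (by omega)]
  · rw [if_neg h, intervalVal_eq_zero h]

/-- A direct summand of an interval representation that vanishes at its first vertex vanishes. -/
theorem isZeroRep_of_iso_directSum {a b : ℕ} {X Y : QuiverRep K (PathQuiver n)}
    (e : intervalRep K n a b ≅ directSum X Y)
    (h : ∀ v : PathQuiver n, v.idx = a → Subsingleton (Y.obj v)) : Y.IsZeroRep := fun v => by
  induction v using path_induction with
  | zero v hv =>
    by_cases hva : v.idx = a
    · exact h v hva
    · refine subsingleton_of_forall_eq 0 fun y => ?_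
      have h₁ := app_hom_app_inv e v ((0, y) : X.obj v × Y.obj v)
      have h₂ : Hom.app e.inv v ((0, y) : X.obj v × Y.obj v) = 0 := intervalVal_injective <| by
        rw [intervalVal_eq_zero (by omega), map_zero]
      rw [h₂, map_zero] at h₁
      exact (congrArg Prod.snd h₁).symm
  | succ v w α ih =>
    by_cases hwa : w.idx = a
    · exact h w hwa
    · refine subsingleton_of_forall_eq 0 fun y => ?_
      have h₁ := app_hom_app_inv e w ((0, y) : X.obj w × Y.obj w)
      obtain ⟨m, hm⟩ := intervalRep_map_surjective α hwa
        (Hom.app e.inv w ((0, y) : X.obj w × Y.obj w))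
      rw [← hm, ← comm_apply] at h₁
      have h₂ : Y.map α (Hom.app e.hom v m).2 = y := congrArg Prod.snd h₁
      rw [← h₂, ih.elim (Hom.app e.hom v m).2 0, map_zero]

/-- The morphism that exchanges the two summands of a direct sum. -/
def directSumComm {Q : Type w} [Quiver.{v} Q] (X Y : QuiverRep K Q) :
    directSum X Y ⟶ directSum Y X :=
  Hom.mk (V := directSum X Y) (W := directSum Y X)
    (fun i => (LinearEquiv.prodComm K (X.obj i) (Y.obj i)).toLinearMap) fun _ => rfl

theorem isIndecomposable_intervalRep {a b : ℕ} (hab : a < b) (hbn : b ≤ n) :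
    (intervalRep K n a b).IsIndecomposable := by
  have han : a < n := by omega
  refine ⟨fun h => ?_, fun X Y ⟨e⟩ => ?_⟩
  · have h₁ := congrArg intervalVal ((h (vertex a han)).elim (intervalMk a b _ (1 : K)) 0)
    rw [intervalVal_intervalMk, map_zero, if_pos (by rw [idx_vertex]; omega)] at h₁
    exact one_ne_zero h₁
  · have hor : Subsingleton (X.obj (vertex a han)) ∨ Subsingleton (Y.obj (vertex a han)) := by
      by_contra! hc
      obtain ⟨hX, hY⟩ := hc
      obtain ⟨x, hx⟩ := exists_ne (0 : X.obj (vertex a han))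
      obtain ⟨y, hy⟩ := exists_ne (0 : Y.obj (vertex a han))
      -- `(x, 0)` and `(0, y)` correspond to elements `s`, `t` of a line, so `t • x = 0`.
      set s := Hom.app e.inv _ ((x, 0) : X.obj (vertex a han) × Y.obj (vertex a han)) with hs
      set t := Hom.app e.inv _ ((0, y) : X.obj (vertex a han) × Y.obj (vertex a han)) with ht
      have hes := app_hom_app_inv e _ ((x, 0) : X.obj (vertex a han) × Y.obj (vertex a han))
      have het := app_hom_app_inv e _ ((0, y) : X.obj (vertex a han) × Y.obj (vertex a han))
      rw [← hs] at hes
      rw [← ht] at het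
      have hst : intervalVal t • s = intervalVal s • t := intervalVal_injective <| by
        rw [map_smul, map_smul, smul_eq_mul, smul_eq_mul, mul_comm]
      have h₁ := congrArg (Hom.app e.hom _) hst
      rw [map_smul, map_smul, hes, het] at h₁
      have h₂ : intervalVal t • x = intervalVal s • (0 : X.obj (vertex a han)) :=
        congrArg Prod.fst h₁
      rw [smul_zero, smul_eq_zero, or_iff_left hx] at h₂
      have h₃ : t = 0 := intervalVal_injective (by rw [h₂, map_zero])
      rw [h₃, map_zero] at het
      exact hy (congrArg Prod.snd het).symm
    rcases hor with h | h
    · left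
      refine isZeroRep_of_iso_directSum (e ≪≫ isoOfBijective (directSumComm X Y)
        fun i => (LinearEquiv.prodComm K (X.obj i) (Y.obj i)).bijective) fun v hv => ?_
      obtain rfl : v = vertex a han := idx_injective hv
      exact h
    · right
      refine isZeroRep_of_iso_directSum e fun v hv => ?_
      obtain rfl : v = vertex a han := idx_injective hv
      exact h

/-- A nonzero morphism from `[i, j)` to `[k, l)` exists only if `k ≤ i < l ≤ j`: its image is a
quotient of the former and a subrepresentation of the latter. -/
theorem intervalRep_hom_eq_zero {i j k l : ℕ} (h : k ≤ i → i < l → j < l) (hl : l ≤ n)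
    (f : intervalRep K n i j ⟶ intervalRep K n k l) (v : PathQuiver n) : Hom.app f v = 0 := by
  have hsrc : ∀ v : PathQuiver n, ¬ (i ≤ v.idx ∧ v.idx < j) → Hom.app f v = 0 := fun v hv =>
    LinearMap.ext fun x => by
      have hx : x = 0 := intervalVal_injective (by rw [intervalVal_eq_zero hv, map_zero])
      rw [hx, map_zero, map_zero]
  have htgt : ∀ v : PathQuiver n, ¬ (k ≤ v.idx ∧ v.idx < l) → Hom.app f v = 0 := fun v hv =>
    LinearMap.ext fun x => intervalVal_injective <| by
      rw [intervalVal_eq_zero hv, LinearMap.zero_apply, map_zero]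
  by_cases hki : k ≤ i
  · -- Here the target extends beyond the source, so vanishing propagates backwards from `j`.
    by_cases hv : i ≤ v.idx ∧ v.idx < j
    swap
    · exact hsrc v hv
    by_cases hv' : v.idx < l
    swap
    · exact htgt v fun h => hv' h.2
    have hjl := h hki (by omega)
    obtain ⟨d, hd⟩ : ∃ d, v.idx + d = j := ⟨j - v.idx, by omega⟩
    replace hv := hv.1
    clear hv'
    induction d generalizing v with
    | zero => exact hsrc v (by omega)
    | succ d ih =>
      let w : PathQuiver n := vertex (v.idx + 1) (by omega)
      have hw : w.idx = v.idx + 1 := rfl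
      have α : v ⟶ w := ⟨rfl⟩
      refine LinearMap.ext fun x => intervalVal_injective ?_
      have h₁ := congrArg intervalVal (comm_apply f α x)
      rw [intervalVal_map, if_pos (by omega), ih w (by omega) (by omega)] at h₁
      exact h₁
  · -- Here the source is generated before `k`, so vanishing propagates forwards.
    induction v using path_induction with
    | zero v hv => exact htgt v (by omega)
    | succ v w α ih =>
      by_cases hw : k ≤ w.idx
      · refine LinearMap.ext fun x => ?_
        obtain ⟨y, rfl⟩ := intervalRep_map_surjective α (by omega) x
        rw [← comm_apply, ih, LinearMap.zero_apply, map_zero, LinearMap.zero_apply]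
      · exact htgt w fun h => hw h.1

/-! ### Decomposition into interval representations -/

/-- A nonzero representation has an interval representation as a direct summand: take an element
of the first nonzero space whose images along the path survive as long as possible, and a linear
functional that does not vanish on the last nonzero image. -/
theorem exists_retraction_intervalRep (X : QuiverRep K (PathQuiver n)) (hX : ¬ X.IsZeroRep) :
    ∃ a b : ℕ, a < b ∧ b ≤ n ∧
      ∃ (ι : intervalRep K n a b ⟶ X) (ρ : X ⟶ intervalRep K n a b),
        ∀ v x, Hom.app ρ v (Hom.app ι v x) = x := by
  classical
  obtain ⟨v, hv⟩ := not_forall.1 hX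
  obtain ⟨s, hs, hmin⟩ := Finset.exists_min_image
    (Finset.univ.filter fun v : PathQuiver n => ¬ Subsingleton (X.obj v)) idx ⟨v, by simpa using hv⟩
  have hs : ¬ Subsingleton (X.obj s) := by simpa using hs
  have hmin : ∀ v : PathQuiver n, v.idx < s.idx → Subsingleton (X.obj v) := fun v hv => by
    by_contra hc
    exact absurd (hmin v (by simpa using hc)) (by omega)
  have hss : transport X s s ≠ 0 := by
    intro h
    rw [transport_self] at h
    exact hs (subsingleton_of_forall_eq 0 fun x => LinearMap.congr_fun h x)
  obtain ⟨e, he, hmax⟩ := Finset.exists_max_image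
    (Finset.univ.filter fun v : PathQuiver n => transport X s v ≠ 0) idx ⟨s, by simpa using hss⟩
  have he : transport X s e ≠ 0 := by simpa using he
  have hmax : ∀ v : PathQuiver n, e.idx < v.idx → transport X s v = 0 := fun v hv => by
    by_contra hc
    exact absurd (hmax v (by simpa using hc)) (by omega)
  have hse : s.idx ≤ e.idx := by
    by_contra hc
    exact he (transport_of_lt X s e (by omega))
  obtain ⟨x, hx⟩ : ∃ x, transport X s e x ≠ 0 := by
    by_contra! hc
    exact he (LinearMap.ext hc)
  obtain ⟨φ, hφ⟩ : ∃ φ : Module.Dual K (X.obj e), φ (transport X s e x) = 1 := by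
    obtain ⟨φ, hφ⟩ : ∃ φ : Module.Dual K (X.obj e), φ (transport X s e x) ≠ 0 := by
      by_contra! hc
      exact hx ((Module.forall_dual_apply_eq_zero_iff K _).1 hc)
    exact ⟨(φ (transport X s e x))⁻¹ • φ, inv_mul_cancel₀ hφ⟩
  refine ⟨s.idx, e.idx + 1, by omega, e.idx_lt,
    Hom.mk (V := intervalRep K n s.idx (e.idx + 1)) (W := X) (fun v =>
      LinearMap.toSpanSingleton K (X.obj v) (transport X s v x) ∘ₗ intervalVal) ?_,
    Hom.mk (V := X) (W := intervalRep K n s.idx (e.idx + 1)) (fun v =>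
      intervalMk _ _ v ∘ₗ φ ∘ₗ transport X v e) ?_, fun v y => ?_⟩
  · intro v w α
    have hα := idx_of_hom α
    refine LinearMap.ext fun y => ?_
    simp only [LinearMap.comp_apply, LinearMap.toSpanSingleton_apply, map_smul, intervalVal_map]
    by_cases hv : s.idx ≤ v.idx ∧ v.idx < e.idx + 1
    · rw [← LinearMap.comp_apply, map_comp_transport X α hv.1]
      by_cases hw : e.idx < w.idx
      · rw [hmax w hw, LinearMap.zero_apply, smul_zero, smul_zero]
      · rw [if_pos (by omega)]
    · rw [intervalVal_eq_zero hv]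
      simp
  · intro v w α
    have hα := idx_of_hom α
    refine LinearMap.ext fun z => intervalVal_injective ?_
    simp only [LinearMap.comp_apply, intervalVal_map, intervalVal_intervalMk]
    by_cases hw : s.idx ≤ w.idx ∧ w.idx < e.idx + 1
    · rw [← LinearMap.comp_apply (transport X w e), transport_comp_map X α (by omega)]
      by_cases hv : v.idx < s.idx
      · have := hmin v hv
        rw [Subsingleton.elim z 0]
        simp
      · rw [if_pos hw, if_pos hw, if_pos (by omega)]
    · rw [if_neg hw, if_neg hw]
  · apply intervalVal_injective
    change intervalVal (intervalMk _ _ v (φ (transport X v e (intervalVal y • transport X s v x))))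
      = _
    rw [intervalVal_intervalMk]
    by_cases hv : s.idx ≤ v.idx ∧ v.idx < e.idx + 1
    · rw [if_pos hv, map_smul, ← LinearMap.comp_apply (transport X v e),
        transport_comp_transport X e hv.1 (by omega), map_smul, hφ, smul_eq_mul, mul_one]
    · rw [if_neg hv, intervalVal_eq_zero hv]

theorem exists_iso_finiteDirectSum_intervalRep (X : QuiverRep K (PathQuiver n)) :
    ∃ (m : ℕ) (a b : Fin m → ℕ), (∀ k, a k < b k ∧ b k ≤ n) ∧
      Nonempty (finiteDirectSum (fun k => intervalRep K n (a k) (b k)) ≅ X) := by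
  obtain ⟨d, hd⟩ : ∃ d, ∑ v, Module.finrank K (X.obj v) = d := ⟨_, rfl⟩
  induction d using Nat.strong_induction_on generalizing X with
  | _ d ih =>
    by_cases hX : X.IsZeroRep
    · refine ⟨0, Fin.elim0, Fin.elim0, fun k => k.elim0, ⟨isoOfBijective
        (Hom.mk (V := finiteDirectSum _) (W := X) (fun _ => 0) fun α => by simp) fun i => ?_⟩⟩
      exact ⟨fun x y _ => funext fun k => k.elim0, fun y => ⟨0, (hX i).elim _ _⟩⟩
    · obtain ⟨a, b, hab, hbn, ι, ρ, h⟩ := exists_retraction_intervalRep X hX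
      have hle : ∀ v, Module.finrank K ((kernelRep ρ).obj v) ≤ Module.finrank K (X.obj v) :=
        fun v => Submodule.finrank_le (LinearMap.ker (Hom.app ρ v))
      have hlt : Module.finrank K ((kernelRep ρ).obj (vertex a (by omega))) <
          Module.finrank K (X.obj (vertex a (by omega))) := by
        refine Submodule.finrank_lt (s := LinearMap.ker (Hom.app ρ (vertex a (by omega))))
          fun htop => ?_
        have h₁ := h (vertex a (by omega)) (intervalMk a b _ (1 : K))
        rw [LinearMap.ker_eq_top.1 htop, LinearMap.zero_apply] at h₁
        have h₂ := congrArg intervalVal h₁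
        rw [map_zero, intervalVal_intervalMk, if_pos (by rw [idx_vertex]; omega)] at h₂
        exact zero_ne_one h₂
      obtain ⟨m, a', b', hab', ⟨e⟩⟩ := ih _
        (hd ▸ Finset.sum_lt_sum (fun v _ => hle v) ⟨_, Finset.mem_univ _, hlt⟩) (kernelRep ρ) rfl
      obtain ⟨e'⟩ := nonempty_iso_directSum_kernelRep ι ρ h
      let V : Fin (m + 1) → QuiverRep K (PathQuiver n) := fun k =>
        intervalRep K n ((Fin.cons a a' : Fin (m + 1) → ℕ) k) ((Fin.cons b b' : Fin (m + 1) → ℕ) k)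
      let f : directSum (intervalRep K n a b)
            (finiteDirectSum fun k => intervalRep K n (a' k) (b' k)) ⟶
          directSum (intervalRep K n a b) (kernelRep ρ) :=
        Hom.mk (V := directSum _ _) (W := directSum _ _)
          (fun v => LinearMap.id.prodMap (Hom.app e.hom v)) fun α => LinearMap.ext fun x =>
            Prod.ext rfl (comm_apply e.hom α x.2)
      have hf : ∀ v, Function.Bijective (Hom.app f v) := fun v =>
        Function.bijective_id.prodMap (Function.bijective_iff_has_inverse.2
          ⟨Hom.app e.inv v, app_inv_app_hom e v, app_hom_app_inv e v⟩)
      refine ⟨m + 1, Fin.cons a a', Fin.cons b b', fun k => ?_,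
        ⟨(isoOfBijective _ (bijective_finiteDirectSumCons V)).symm ≪≫ isoOfBijective f hf ≪≫ e'⟩⟩
      exact Fin.cases ⟨hab, hbn⟩ hab' k

/-- A class closed under quotients and extensions is determined by its interval
representations. -/
theorem IsQuotExtClosed.le_iff {B B' : ObjectProperty (QuiverRep K (PathQuiver n))}
    (hB : IsQuotExtClosed B) (hB' : IsQuotExtClosed B') :
    B ≤ B' ↔ ∀ a b, a < b → b ≤ n → B (intervalRep K n a b) → B' (intervalRep K n a b) := by
  refine ⟨fun h a b _ _ => h _, fun h X hX => ?_⟩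
  obtain ⟨m, a, b, hab, ⟨e⟩⟩ := exists_iso_finiteDirectSum_intervalRep X
  rw [← hB.iff_of_iso e, hB.finiteDirectSum_iff] at hX
  rw [← hB'.iff_of_iso e, hB'.finiteDirectSum_iff]
  exact fun k => h _ _ (hab k).1 (hab k).2 (hX k)

theorem IsQuotExtClosed.isTorsionClass {B : ObjectProperty (QuiverRep K (PathQuiver n))}
    (hB : IsQuotExtClosed B) : IsTorsionClass B where
  additive := by
    refine ⟨{V | B V ∧ ∃ a b, a < b ∧ b ≤ n ∧ V = intervalRep K n a b}, ?_, fun X => ⟨?_, ?_⟩⟩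
    · rintro V ⟨-, a, b, hab, hbn, rfl⟩
      exact isIndecomposable_intervalRep hab hbn
    · intro hX
      obtain ⟨m, a, b, hab, ⟨e⟩⟩ := exists_iso_finiteDirectSum_intervalRep X
      rw [← hB.iff_of_iso e, hB.finiteDirectSum_iff] at hX
      exact ⟨m, _, fun k => ⟨hX k, a k, b k, (hab k).1, (hab k).2, rfl⟩, ⟨e.symm⟩⟩
    · rintro ⟨m, V, hV, ⟨e⟩⟩
      rw [hB.iff_of_iso e, hB.finiteDirectSum_iff]
      exact fun k => (hV k).1
  quotient := hB.quotient
  extension := hB.extension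

/-! ### Torsion classes and bracket vectors -/

/-- The torsion class that corresponds to a vector `r`, described by the torsion-free
representations it is orthogonal to: the class of all representations without nonzero morphisms to
the interval representations `[k, l)` such that `i + r i < l` for all `i` in `[k, l)`. -/
def homOrthogonal (K : Type u) [Field K] (n : ℕ) (r : ℕ → ℕ) :
    ObjectProperty (QuiverRep K (PathQuiver n)) := fun X =>
  ∀ k l, l ≤ n → (∀ i, k ≤ i → i < l → i + r i < l) →
    ∀ (f : X ⟶ intervalRep K n k l) (v : PathQuiver n), Hom.app f v = 0

theorem isQuotExtClosed_homOrthogonal (r : ℕ → ℕ) : IsQuotExtClosed (homOrthogonal K n r) where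
  zero hX := fun _ _ _ _ f v => LinearMap.ext fun x => by
    rw [(hX v).elim x 0, map_zero, map_zero]
  quotient g hg hY := fun k l hl h f v => LinearMap.ext fun z => by
    obtain ⟨y, rfl⟩ := hg v z
    exact LinearMap.congr_fun (hY k l hl h (g ≫ f) v) y
  extension := by
    rintro X Y Z ⟨ι, π, -, hπ, hex⟩ hX hZ k l hl h f
    have hfι : ∀ v x, Hom.app f v (Hom.app ι v x) = 0 := fun v x =>
      LinearMap.congr_fun (hX k l hl h (ι ≫ f) v) x
    have hker : ∀ v y y', Hom.app π v y = Hom.app π v y' → Hom.app f v y = Hom.app f v y' := by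
      intro v y y' hy
      have hmem : y - y' ∈ LinearMap.ker (Hom.app π v) := by
        rw [LinearMap.mem_ker, map_sub, hy, sub_self]
      rw [← hex] at hmem
      obtain ⟨x, hx⟩ := hmem
      have := hfι v x
      rwa [hx, map_sub, sub_eq_zero] at this
    -- `f` vanishes on the subrepresentation `X`, so it factors through `Z`.
    let s : ∀ v, Z.obj v → Y.obj v := fun v => Function.surjInv (hπ v)
    have hs : ∀ v z, Hom.app π v (s v z) = z := fun v => Function.surjInv_eq (hπ v)
    let g : Z ⟶ intervalRep K n k l := Hom.mk (V := Z) (W := intervalRep K n k l)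
      (fun v =>
        { toFun := fun z => Hom.app f v (s v z)
          map_add' := fun z z' => by
            rw [← map_add]
            exact hker v _ _ (by rw [map_add, hs, hs, hs])
          map_smul' := fun c z => by
            rw [RingHom.id_apply, ← map_smul]
            exact hker v _ _ (by rw [map_smul, hs, hs]) })
      fun {v w} α => LinearMap.ext fun z => by
        change (intervalRep K n k l).map α (Hom.app f v (s v z)) = Hom.app f w (s w (Z.map α z))
        rw [comm_apply]
        exact hker w _ _ (by rw [← comm_apply, hs, hs])
    refine fun v => LinearMap.ext fun y => ?_
    have hg : Hom.app f v (s v (Hom.app π v y)) = 0 :=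
      LinearMap.congr_fun (hZ k l hl h g v) (Hom.app π v y)
    rw [hker v y _ (hs v _).symm, hg, LinearMap.zero_apply]

theorem homOrthogonal_intervalRep_iff {r : ℕ → ℕ}
    (hnest : ∀ i j, i ≤ n → i ≤ j → j ≤ i + r i → j + r j ≤ i + r i) {i j : ℕ}
    (hij : i < j) (hjn : j ≤ n) :
    homOrthogonal K n r (intervalRep K n i j) ↔ j ≤ i + r i := by
  constructor
  · intro h
    by_contra! hj
    -- The interval `[i, i + r i + 1)` yields a nonzero quotient of `[i, j)`.
    have h₁ := h i (i + r i + 1) (by omega)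
      (fun i' h₁ h₂ => by have := hnest i i' (by omega) h₁ (by omega); omega)
      (intervalHom le_rfl hj) (vertex i (by omega))
    have h₂ := congrArg intervalVal (LinearMap.congr_fun h₁ (intervalMk i j _ (1 : K)))
    rw [intervalVal_intervalHom, intervalVal_intervalMk, idx_vertex, if_pos (by omega),
      if_pos (by omega), LinearMap.zero_apply, map_zero] at h₂
    exact one_ne_zero h₂
  · intro h k l hl hr f v
    exact intervalRep_hom_eq_zero (fun h₁ h₂ => by have := hr i h₁ h₂; omega) hl f v

/-- The interval representations in a class closed under quotients and extensions are given by a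
vector with nested or disjoint intervals. -/
theorem IsQuotExtClosed.exists_vector {B : ObjectProperty (QuiverRep K (PathQuiver n))}
    (hB : IsQuotExtClosed B) :
    ∃ r : ℕ → ℕ, (∀ i < n + 1, i + r i < n + 1) ∧
      (∀ i j, i < n + 1 → i ≤ j → j ≤ i + r i → j + r j ≤ i + r i) ∧
      ∀ i j, i < j → j ≤ n → (B (intervalRep K n i j) ↔ j ≤ i + r i) := by
  classical
  -- `r i` is the length of the longest interval in `B` that starts at `i`; the empty interval, whose
  -- representation is zero, always qualifies.
  let P : ℕ → ℕ → Prop := fun i d => i + d ≤ n ∧ B (intervalRep K n i (i + d))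
  have hP0 : ∀ i ≤ n, P i 0 := fun i hi => ⟨hi, hB.zero (isZeroRep_intervalRep le_rfl)⟩
  have hspec : ∀ i ≤ n, P i (Nat.findGreatest (P i) n) := fun i hi =>
    Nat.findGreatest_spec (Nat.zero_le n) (hP0 i hi)
  have hle : ∀ i d, P i d → d ≤ Nat.findGreatest (P i) n := fun i d hd =>
    Nat.le_findGreatest (by have := hd.1; omega) hd
  refine ⟨fun i => Nat.findGreatest (P i) n, fun i hi => ?_, fun i j hi hij hj => ?_,
    fun i j hij hjn => ⟨fun h => ?_, fun h => ?_⟩⟩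
  · have := (hspec i (by omega)).1
    dsimp only
    omega
  · dsimp only at hj ⊢
    have hi' := hspec i (by omega)
    have hj' := hspec j (by have := hi'.1; omega)
    have key := hle i (j + Nat.findGreatest (P j) n - i)
      ⟨by have := hj'.1; omega, by
        rw [show i + (j + Nat.findGreatest (P j) n - i) = j + Nat.findGreatest (P j) n by omega]
        exact hB.extension (isExtension_intervalRep hij (by omega)) hj'.2
          (hB.quotient _ (isSurjection_intervalHom hj) hi'.2)⟩
    omega
  · have key := hle i (j - i) ⟨by omega, by rwa [show i + (j - i) = j by omega]⟩
    dsimp only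
    omega
  · exact hB.quotient _ (isSurjection_intervalHom h) (hspec i (by omega)).2

end Path

end QuiverRep

/-! ### Bracket vectors of binary trees -/

/-- The bracket vector of a binary tree: the size of the right subtree of the `i`-th node, where
the nodes are numbered from `0` in inorder. Its value is `0` if there is no `i`-th node. -/
def bracketVector : BinaryTree Unit → ℕ → ℕ
  | .nil, _ => 0
  | .node _ A B, i =>
    if i < A.numNodes then bracketVector A i
    else if i = A.numNodes then B.numNodes
    else bracketVector B (i - A.numNodes - 1)

theorem bracketVector_node_left {A : BinaryTree Unit} (B : BinaryTree Unit) {i : ℕ}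
    (h : i < A.numNodes) : bracketVector (.node () A B) i = bracketVector A i := by
  simp [bracketVector, h]

theorem bracketVector_node_root (A B : BinaryTree Unit) :
    bracketVector (.node () A B) A.numNodes = B.numNodes := by
  simp [bracketVector]

theorem bracketVector_node_right (A B : BinaryTree Unit) (i : ℕ) :
    bracketVector (.node () A B) (A.numNodes + 1 + i) = bracketVector B i := by
  have h₁ : ¬ A.numNodes + 1 + i < A.numNodes := by omega
  have h₂ : ¬ A.numNodes + 1 + i = A.numNodes := by omega
  have h₃ : A.numNodes + 1 + i - A.numNodes - 1 = i := by omega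
  simp only [bracketVector, h₁, h₂, h₃, if_false]

/-- If the left subtree has `p` nodes, the node `i` lies in it, is the root, or lies in the right
subtree. -/
theorem node_index_cases (p i : ℕ) : i < p ∨ i = p ∨ ∃ j, i = p + 1 + j := by
  rcases lt_trichotomy i p with h | h | h
  · exact Or.inl h
  · exact Or.inr (Or.inl h)
  · exact Or.inr (Or.inr ⟨i - p - 1, by omega⟩)

theorem add_bracketVector_lt (t : BinaryTree Unit) {i : ℕ} (hi : i < t.numNodes) :
    i + bracketVector t i < t.numNodes := by
  induction t generalizing i with
  | nil => simp [BinaryTree.numNodes] at hi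
  | node a A B ihA ihB =>
    simp only [BinaryTree.numNodes] at hi ⊢
    rcases node_index_cases A.numNodes i with h | rfl | ⟨j, rfl⟩
    · rw [bracketVector_node_left B h]
      have := ihA h
      omega
    · rw [bracketVector_node_root]
      omega
    · rw [bracketVector_node_right]
      have := ihB (i := j) (by omega)
      omega

/-- The intervals `[i, i + bracketVector t i]` are nested or disjoint: they are the sets of nodes
in the right subtrees, together with their parents. -/
theorem bracketVector_nested (t : BinaryTree Unit) {i j : ℕ} (hi : i < t.numNodes) (hij : i ≤ j)
    (hj : j ≤ i + bracketVector t i) :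
    j + bracketVector t j ≤ i + bracketVector t i := by
  induction t generalizing i j with
  | nil => simp [BinaryTree.numNodes] at hi
  | node a A B ihA ihB =>
    simp only [BinaryTree.numNodes] at hi
    rcases node_index_cases A.numNodes i with h | rfl | ⟨i, rfl⟩
    · rw [bracketVector_node_left B h] at hj ⊢
      have := add_bracketVector_lt A h
      have hj' : j < A.numNodes := by omega
      rw [bracketVector_node_left B hj']
      exact ihA h hij hj
    · rw [bracketVector_node_root] at hj ⊢
      rcases node_index_cases A.numNodes j with h | rfl | ⟨j, rfl⟩
      · omega
      · rw [bracketVector_node_root]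
      · rw [bracketVector_node_right]
        have := add_bracketVector_lt B (i := j) (by omega)
        omega
    · rw [bracketVector_node_right] at hj ⊢
      obtain ⟨j, rfl⟩ : ∃ k, j = A.numNodes + 1 + k := ⟨j - A.numNodes - 1, by omega⟩
      rw [bracketVector_node_right]
      have := ihB (i := i) (j := j) (by omega) (by omega) (by omega)
      omega

/-- Every vector of nested or disjoint intervals is a bracket vector. The root is the first node
whose interval reaches the end of the word. -/
theorem exists_bracketVector_eq (m : ℕ) (r : ℕ → ℕ) (hr : ∀ i < m, i + r i < m)
    (hnest : ∀ i j, i < m → i ≤ j → j ≤ i + r i → j + r j ≤ i + r i) :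
    ∃ t : BinaryTree Unit, t.numNodes = m ∧ ∀ i < m, bracketVector t i = r i := by
  induction m using Nat.strong_induction_on generalizing r with
  | _ m ih =>
    rcases m with _ | m
    · exact ⟨.nil, rfl, by simp⟩
    have hex : ∃ i, i < m + 1 ∧ i + r i = m := ⟨m, by omega, by have := hr m (by omega); omega⟩
    classical
    obtain ⟨hpm, hp⟩ := Nat.find_spec hex
    have hmin : ∀ i < Nat.find hex, ¬ (i < m + 1 ∧ i + r i = m) := fun i hi => Nat.find_min hex hi
    generalize Nat.find hex = p at hpm hp hmin
    obtain ⟨A, hA, hA'⟩ := ih p hpm r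
      (fun i hi => by
        by_contra h
        have h₁ := hnest i p (by omega) hi.le (by omega)
        have h₂ := hr i (by omega)
        exact hmin i hi ⟨by omega, by omega⟩)
      (fun i j hi => hnest i j (by omega))
    obtain ⟨B, hB, hB'⟩ := ih (m - p) (by omega) (fun i => r (p + 1 + i))
      (fun i hi => by
        have := hr (p + 1 + i) (by omega)
        omega)
      (fun i j hi hij hj => by
        have := hnest (p + 1 + i) (p + 1 + j) (by omega) (by omega) (by omega)
        omega)
    refine ⟨.node () A B, by simp only [BinaryTree.numNodes]; omega, fun i hi => ?_⟩
    subst hA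
    rcases node_index_cases A.numNodes i with h | rfl | ⟨j, rfl⟩
    · rw [bracketVector_node_left B h, hA' i h]
    · rw [bracketVector_node_root]
      omega
    · rw [bracketVector_node_right, hB' j (by omega)]

/-! ### The Tamari order in terms of bracket vectors -/

theorem numNodes_eq_of_reflTransGen {s t : BinaryTree Unit}
    (h : Relation.ReflTransGen TamariStep s t) : s.numNodes = t.numNodes := by
  induction h with
  | refl => rfl
  | tail _ h ih => exact ih.trans h.numNodes_eq

theorem reflTransGen_node {A A' B B' : BinaryTree Unit}
    (hA : Relation.ReflTransGen TamariStep A A') (hB : Relation.ReflTransGen TamariStep B B') :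
    Relation.ReflTransGen TamariStep (.node () A B) (.node () A' B') :=
  (Relation.ReflTransGen.lift (fun T => BinaryTree.node () T B)
    (fun _ _ h => TamariStep.left B h) _ _ hA).trans
    (Relation.ReflTransGen.lift (fun T => BinaryTree.node () A' T)
      (fun _ _ h => TamariStep.right A' h) _ _ hB)

/-- A rotation changes the bracket vector only at the root of the rotated left factor, which
becomes the new root. -/
theorem bracketVector_rotate (A B C : BinaryTree Unit) {i : ℕ} (hi : i ≠ A.numNodes) :
    bracketVector (.node () A (.node () B C)) i =
      bracketVector (.node () (.node () A B) C) i := by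
  have hAB : (BinaryTree.node () A B).numNodes = A.numNodes + 1 + B.numNodes := by
    simp only [BinaryTree.numNodes]; omega
  rcases node_index_cases A.numNodes i with h | h | ⟨j, rfl⟩
  · rw [bracketVector_node_left _ h, bracketVector_node_left _ (by omega),
      bracketVector_node_left _ h]
  · exact absurd h hi
  · rw [bracketVector_node_right]
    rcases node_index_cases B.numNodes j with h | rfl | ⟨k, rfl⟩
    · rw [bracketVector_node_left _ h, bracketVector_node_left _ (by omega),
        bracketVector_node_right]
    · rw [bracketVector_node_root, ← hAB, bracketVector_node_root]
    · rw [bracketVector_node_right, ← bracketVector_node_right (.node () A B) C k, hAB]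
      congr 1
      omega

theorem TamariStep.bracketVector_le {s t : BinaryTree Unit} (h : TamariStep s t) (i : ℕ) :
    bracketVector s i ≤ bracketVector t i := by
  induction h generalizing i with
  | rotate A B C =>
    by_cases hi : i = A.numNodes
    · subst hi
      rw [bracketVector_node_left C (by simp only [BinaryTree.numNodes]; omega),
        bracketVector_node_root, bracketVector_node_root]
      simp only [BinaryTree.numNodes]
      omega
    · rw [bracketVector_rotate A B C hi]
  | @left A A' B h ih =>
    have hn := h.numNodes_eq
    rcases node_index_cases A.numNodes i with h | rfl | ⟨j, rfl⟩
    · rw [bracketVector_node_left B h, bracketVector_node_left B (by omega)]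
      exact ih i
    · rw [bracketVector_node_root, hn, bracketVector_node_root]
    · rw [bracketVector_node_right, hn, bracketVector_node_right]
  | @right A B B' h ih =>
    rcases node_index_cases A.numNodes i with h' | rfl | ⟨j, rfl⟩
    · rw [bracketVector_node_left _ h', bracketVector_node_left _ h']
    · rw [bracketVector_node_root, bracketVector_node_root, h.numNodes_eq]
    · rw [bracketVector_node_right, bracketVector_node_right]
      exact ih j

/-- If no right subtree of an earlier node contains the node `p`, then `p` lies on the left spine
of the tree, and rotations bring it to the root without changing the bracket vector elsewhere. -/
theorem exists_reflTransGen_root (s : BinaryTree Unit) {p : ℕ} (hp : p < s.numNodes)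
    (h : ∀ i < p, i + bracketVector s i < p) :
    ∃ A B : BinaryTree Unit, A.numNodes = p ∧
      Relation.ReflTransGen TamariStep s (.node () A B) ∧
      ∀ i ≠ p, bracketVector (.node () A B) i = bracketVector s i := by
  induction s with
  | nil => simp [BinaryTree.numNodes] at hp
  | node a A B ihA _ =>
    rcases lt_trichotomy p A.numNodes with hpA | rfl | hpA
    · obtain ⟨A₁, A₂, rfl, hs, hv⟩ := ihA hpA fun i hi => by
        have := h i hi
        rwa [bracketVector_node_left B (by omega)] at this
      have hn := numNodes_eq_of_reflTransGen hs
      refine ⟨A₁, .node () A₂ B, rfl,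
        (reflTransGen_node hs .refl).tail (.rotate A₁ A₂ B), fun i hi => ?_⟩
      rw [bracketVector_rotate A₁ A₂ B hi]
      rcases node_index_cases A.numNodes i with h' | rfl | ⟨j, rfl⟩
      · rw [bracketVector_node_left B h', bracketVector_node_left B (by omega), hv i hi]
      · rw [bracketVector_node_root, hn, bracketVector_node_root]
      · rw [bracketVector_node_right, hn, bracketVector_node_right]
    · exact ⟨A, B, rfl, .refl, fun _ _ => rfl⟩
    · have := h _ hpA
      rw [bracketVector_node_root] at this
      simp only [BinaryTree.numNodes] at hp
      omega

theorem reflTransGen_of_bracketVector_le {s t : BinaryTree Unit} (hn : s.numNodes = t.numNodes)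
    (h : ∀ i < s.numNodes, bracketVector s i ≤ bracketVector t i) :
    Relation.ReflTransGen TamariStep s t := by
  induction t generalizing s with
  | nil =>
    cases s with
    | nil => exact .refl
    | node a A B => simp [BinaryTree.numNodes] at hn
  | node a A' B' ihA ihB =>
    have hn' := hn
    simp only [BinaryTree.numNodes] at hn'
    obtain ⟨A, B, hA, hs, hv⟩ := exists_reflTransGen_root s (p := A'.numNodes) (by omega)
      fun i hi => by
        have h₁ := h i (by omega)
        rw [bracketVector_node_left B' hi] at h₁
        have := add_bracketVector_lt A' hi
        omega
    have hB : s.numNodes = A.numNodes + B.numNodes + 1 := numNodes_eq_of_reflTransGen hs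
    refine hs.trans (reflTransGen_node (ihA hA fun i hi => ?_) (ihB (by omega) fun i hi => ?_))
    · have h₁ := h i (by omega)
      rwa [← hv i (by omega), bracketVector_node_left B hi,
        bracketVector_node_left B' (by omega)] at h₁
    · have h₁ := h (A.numNodes + 1 + i) (by omega)
      rwa [← hv _ (by omega), bracketVector_node_right, hA, bracketVector_node_right] at h₁

theorem TamariLattice.le_iff_bracketVector_le {n : ℕ} (s t : TamariLattice n) :
    s ≤ t ↔ ∀ i ≤ n, bracketVector s.1 i ≤ bracketVector t.1 i := by
  have hs := s.2
  have ht := t.2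
  constructor
  · intro h i _
    change Relation.ReflTransGen TamariStep s.1 t.1 at h
    generalize s.1 = s, t.1 = t at h
    induction h with
    | refl => rfl
    | tail _ h ih => exact ih.trans (h.bracketVector_le i)
  · intro h
    exact reflTransGen_of_bracketVector_le (hs.trans ht.symm) fun i hi => h i (by omega)

/-! ### The isomorphism -/

/-- The torsion class that corresponds to a binary tree. -/
def torsionClassOfTree (K : Type u) [Field K] (n : ℕ) (t : TamariLattice n) :
    TorsionClasses K n :=
  ⟨QuiverRep.homOrthogonal K n (bracketVector t.1),
    (QuiverRep.isQuotExtClosed_homOrthogonal _).isTorsionClass⟩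

theorem torsionClassOfTree_intervalRep_iff {K : Type u} [Field K] {n : ℕ} (t : TamariLattice n)
    {i j : ℕ} (hij : i < j) (hjn : j ≤ n) :
    (torsionClassOfTree K n t).1 (QuiverRep.intervalRep K n i j) ↔
      j ≤ i + bracketVector t.1 i := by
  have ht := t.2
  exact QuiverRep.homOrthogonal_intervalRep_iff
    (fun i j hi => bracketVector_nested t.1 (by omega)) hij hjn

theorem torsionClassOfTree_le_iff {K : Type u} [Field K] {n : ℕ} (s t : TamariLattice n) :
    torsionClassOfTree K n s ≤ torsionClassOfTree K n t ↔ s ≤ t := by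
  have hs := s.2
  rw [← Subtype.coe_le_coe, QuiverRep.IsQuotExtClosed.le_iff
    (torsionClassOfTree K n s).2.isQuotExtClosed (torsionClassOfTree K n t).2.isQuotExtClosed,
    TamariLattice.le_iff_bracketVector_le]
  constructor
  · intro h i hi
    by_contra! hlt
    have hsi := add_bracketVector_lt s.1 (i := i) (by omega)
    have h₁ := h i (i + bracketVector s.1 i) (by omega) (by omega)
    rw [torsionClassOfTree_intervalRep_iff s (by omega) (by omega),
      torsionClassOfTree_intervalRep_iff t (by omega) (by omega)] at h₁
    have := h₁ le_rfl
    omega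
  · intro h a b hab hbn
    rw [torsionClassOfTree_intervalRep_iff s hab hbn, torsionClassOfTree_intervalRep_iff t hab hbn]
    have := h a (by omega)
    omega

theorem torsionClassOfTree_surjective (K : Type u) [Field K] (n : ℕ) :
    Function.Surjective (torsionClassOfTree K n) := fun B => by
  obtain ⟨r, hr, hnest, hB⟩ := B.2.isQuotExtClosed.exists_vector
  obtain ⟨t, htr⟩ : ∃ t : TamariLattice n, ∀ i < n + 1, bracketVector t.1 i = r i := by
    obtain ⟨t, ht, htr⟩ := exists_bracketVector_eq (n + 1) r hr hnest
    exact ⟨⟨t, ht⟩, htr⟩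
  have key : ∀ a b, a < b → b ≤ n →
      ((torsionClassOfTree K n t).1 (QuiverRep.intervalRep K n a b) ↔
        B.1 (QuiverRep.intervalRep K n a b)) := fun a b hab hbn => by
    rw [torsionClassOfTree_intervalRep_iff _ hab hbn, hB a b hab hbn, htr a (by omega)]
  refine ⟨t, Subtype.ext (le_antisymm ?_ ?_)⟩
  · exact (QuiverRep.IsQuotExtClosed.le_iff (torsionClassOfTree K n t).2.isQuotExtClosed
      B.2.isQuotExtClosed).2 fun a b hab hbn => (key a b hab hbn).1
  · exact (QuiverRep.IsQuotExtClosed.le_iff B.2.isQuotExtClosed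
      (torsionClassOfTree K n t).2.isQuotExtClosed).2 fun a b hab hbn => (key a b hab hbn).2

/-- The torsion classes of `rep A_n`, ordered by inclusion, form a poset isomorphic to the Tamari
lattice `T_n`. -/
theorem mainTheorem1 (K : Type u) [Field K] (n : ℕ) :
    Nonempty (TorsionClasses K n ≃o TamariLattice n) :=
  ⟨(RelIso.ofSurjective (OrderEmbedding.ofMapLEIff (torsionClassOfTree K n)
    torsionClassOfTree_le_iff) (torsionClassOfTree_surjective K n)).symm⟩
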